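/- Let $k\ge 1$, let $a_1,\dots,a_k,\ b_1,\dots,b_k,\ c_1,\dots,c_k\in\mathbb C$ be arbitrary, and let $\ell>0$ (the spatial period). Consider the doubly infinite tridiagonal matrix with diagonal entries $a_i$, entries $b_i$ in positions $(i,i+1)$ and entries $c_i$ in positions $(i+1,i)$ ($i\in\mathbb Z$), where all indices of $a,b,c$ are read modulo $k$. Let $L(a)$ be the bounded operator it defines on $\ell^2(\mathbb Z,\mathbb C)$ (the tridiagonal $k$-Laurent operator), and for $m\ge 1$ let $T_{mk}(a)$ be its $mk\times mk$ section on the indices $1,\dots,mk$ (the tridiagonal $k$-Toeplitz matrix). Let $C_{mk}(a)$ be the tridiagonal $k$-circulant matrix, obtained from $T_{mk}(a)$ by adding $c_k$ to the entry in the first row and last column and $b_k$ to the entry in the last row and first column (for $mk\ge 3$ these two entries of $T_{mk}(a)$ are $0$). For $z\in\mathbb C\setminus\{0\}$ let the symbol $a(z)\in\mathbb C^{k\times k}$ be the matrix obtained from $T_{1\cdot k}(a)$ by adding $c_k z$ to the entry in the first row and last column and $b_k z^{-1}$ to the entry in the last row and first column. Let $Y^*=[-\pi/\ell,\pi/\ell)$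 be the real Brillouin zone, and let $\sigma$ denote the spectrum. Then: 1. for every $m\ge1$, $$\sigma(C_{mk}(a))=\bigcup_{j=0}^{m-1}\sigma\big(a(e^{2\pi \mathrm i j/m})\big);$$ 2. as $m\to\infty$, the sets $\sigma(C_{mk}(a))$ converge in the Hausdorff distance to $\bigcup_{\alpha\in Y^*}\sigma\big(a(e^{-\mathrm i\ell\alpha})\big)$; 3. $$\bigcup_{\alpha\in Y^*}\sigma\big(a(e^{-\mathrm i\ell\alpha})\big)=\sigma(L(a)).$$ -/

import Mathlib

open scoped ENNReal

/-- The position of the site `n : ℤ` in its unit cell of `k` sites. -/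
def siteIndex (k : ℕ) [NeZero k] (n : ℤ) : Fin k :=
  ⟨(n % (k : ℤ)).toNat, by
    have hk : (0 : ℤ) < k := by exact_mod_cast Nat.pos_of_ne_zero (NeZero.ne k)
    have h1 := Int.emod_nonneg n hk.ne'
    have h2 := Int.emod_lt_of_pos n hk
    omega⟩

/-- The last position in a unit cell of `k` sites. -/
def lastSite (k : ℕ) [NeZero k] : Fin k :=
  ⟨k - 1, by have := Nat.pos_of_ne_zero (NeZero.ne k); omega⟩

/-- Entries of the doubly infinite `k`-periodic tridiagonal matrix: the diagonal runs through
`a 0, …, a (k-1)`, the superdiagonal (entries `(i, i+1)`) through `b 0, …, b (k-1)` and the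
subdiagonal (entries `(i+1, i)`) through `c 0, …, c (k-1)`, all repeated with period `k`. -/
def tridiagEntry {k : ℕ} [NeZero k] (a b c : Fin k → ℂ) (i j : ℤ) : ℂ :=
  if j = i then a (siteIndex k i)
  else if j = i + 1 then b (siteIndex k i)
  else if i = j + 1 then c (siteIndex k j)
  else 0

/-- The tridiagonal `k`-Toeplitz matrix of order `m * k`: the upper left corner of the
semi-infinite tridiagonal `k`-Toeplitz operator. -/
def toeplitzMatrix {k : ℕ} [NeZero k] (a b c : Fin k → ℂ) (m : ℕ) :
    Matrix (Fin (m * k)) (Fin (m * k)) ℂ :=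
  Matrix.of fun i j => tridiagEntry a b c (i.val : ℤ) (j.val : ℤ)

/-- The tridiagonal `k`-circulant matrix of order `m * k`: the `k`-Toeplitz matrix with the last
`c` placed in the upper right corner and the last `b` in the lower left corner. They are added to
what is there, which matters only for `m * k ≤ 2`, see `circulantMatrix_apply`. -/
def circulantMatrix {k : ℕ} [NeZero k] (a b c : Fin k → ℂ) (m : ℕ) :
    Matrix (Fin (m * k)) (Fin (m * k)) ℂ :=
  Matrix.of fun i j => toeplitzMatrix a b c m i j
    + (if i.val = 0 ∧ j.val + 1 = m * k then c (lastSite k) else 0)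
    + (if i.val + 1 = m * k ∧ j.val = 0 then b (lastSite k) else 0)

/-- For `m * k ≥ 3` the corner entries of the circulant matrix replace zeros. -/
theorem circulantMatrix_apply {k : ℕ} [NeZero k] (a b c : Fin k → ℂ) (m : ℕ) (h : 3 ≤ m * k)
    (i j : Fin (m * k)) :
    circulantMatrix a b c m i j =
      if i.val = 0 ∧ j.val + 1 = m * k then c (lastSite k)
      else if i.val + 1 = m * k ∧ j.val = 0 then b (lastSite k)
      else toeplitzMatrix a b c m i j := by
  simp only [circulantMatrix, toeplitzMatrix, tridiagEntry, Matrix.of_apply]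
  split_ifs <;> first | omega | simp

/-- The symbol `a(z)` of the tridiagonal `k`-Toeplitz (or Laurent) operator: one `k × k` unit cell
of the tridiagonal matrix, with the last `c` times `z` added in the upper right corner and the last
`b` times `z⁻¹` added in the lower left corner. -/
noncomputable def symbol {k : ℕ} [NeZero k] (a b c : Fin k → ℂ) (z : ℂ) :
    Matrix (Fin k) (Fin k) ℂ :=
  Matrix.of fun i j => tridiagEntry a b c (i.val : ℤ) (j.val : ℤ)
    + (if i.val = 0 ∧ j.val + 1 = k then c (lastSite k) * z else 0)
    + (if i.val + 1 = k ∧ j.val = 0 then b (lastSite k) * z⁻¹ else 0)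

theorem siteIndex_block {k : ℕ} [NeZero k] (n : ℤ) (i : Fin k) :
    siteIndex k (n * k + i.val) = i := by
  apply Fin.ext
  simp only [siteIndex]
  rw [Int.add_comm, Int.add_mul_emod_self_right, Int.emod_eq_of_lt (by omega) (by omega)]
  simp

theorem integral_exp_int (q : ℤ) :
    ∫ θ in (0 : ℝ)..(2 * Real.pi), Complex.exp (Complex.I * q * θ) =
      if q = 0 then 2 * Real.pi else 0 := by
  split_ifs with h
  · simp [h]
  · have hq : Complex.I * q ≠ 0 := mul_ne_zero Complex.I_ne_zero (by exact_mod_cast h)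
    rw [integral_exp_mul_complex hq]
    have : Complex.exp (Complex.I * q * ((2 * Real.pi : ℝ) : ℂ)) = 1 := by
      rw [Complex.exp_eq_one_iff]
      exact ⟨q, by push_cast; ring⟩
    rw [this]
    simp

/-- The matrix with entries `tridiagEntry a b c` has the symbol `symbol a b c`: its `k × k` blocks
along the `n`-th block diagonal are the `n`-th Fourier coefficient of the symbol. -/
theorem fourierCoeff_symbol {k : ℕ} [NeZero k] (a b c : Fin k → ℂ) (n : ℤ) (i j : Fin k) :
    (1 / (2 * Real.pi) : ℂ) * ∫ θ in (0 : ℝ)..(2 * Real.pi),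
        symbol a b c (Complex.exp (Complex.I * θ)) i j * Complex.exp (-Complex.I * n * θ) =
      tridiagEntry a b c (n * k + i.val) j.val := by
  set A : ℂ := tridiagEntry a b c (i.val : ℤ) (j.val : ℤ) with hA
  set B : ℂ := if i.val = 0 ∧ j.val + 1 = k then c (lastSite k) else 0 with hB
  set D : ℂ := if i.val + 1 = k ∧ j.val = 0 then b (lastSite k) else 0 with hD
  have hint (q : ℤ) (u : ℂ) : IntervalIntegrable
      (fun θ : ℝ => u * Complex.exp (Complex.I * q * θ)) MeasureTheory.volume 0 (2 * Real.pi) :=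
    Continuous.intervalIntegrable (by fun_prop) _ _
  have hexp (θ : ℝ) :
      symbol a b c (Complex.exp (Complex.I * θ)) i j * Complex.exp (-Complex.I * n * θ) =
        A * Complex.exp (Complex.I * (-n : ℤ) * θ) + B * Complex.exp (Complex.I * (1 - n : ℤ) * θ)
          + D * Complex.exp (Complex.I * (-1 - n : ℤ) * θ) := by
    have h1 : Complex.exp (Complex.I * (1 - n : ℤ) * θ) =
        Complex.exp (Complex.I * θ) * Complex.exp (-Complex.I * n * θ) := by
      rw [← Complex.exp_add]; congr 1; push_cast; ring
    have h2 : Complex.exp (Complex.I * (-1 - n : ℤ) * θ) =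
        (Complex.exp (Complex.I * θ))⁻¹ * Complex.exp (-Complex.I * n * θ) := by
      rw [← Complex.exp_neg, ← Complex.exp_add]; congr 1; push_cast; ring
    have h3 : Complex.exp (Complex.I * (-n : ℤ) * θ) = Complex.exp (-Complex.I * n * θ) := by
      congr 1; push_cast; ring
    rw [h1, h2, h3]
    simp only [symbol, Matrix.of_apply, hA, hB, hD]
    split_ifs <;> ring
  simp_rw [hexp]
  rw [intervalIntegral.integral_add ((hint _ _).add (hint _ _)) (hint _ _),
    intervalIntegral.integral_add (hint _ _) (hint _ _)]
  simp_rw [intervalIntegral.integral_const_mul, integral_exp_int]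
  have hpi : (Real.pi : ℂ) ≠ 0 := by exact_mod_cast Real.pi_ne_zero
  have hi := i.isLt
  have hj := j.isLt
  have hs := siteIndex_block n i
  have hs0 : siteIndex k (j.val : ℤ) = j := by simpa using siteIndex_block 0 j
  have hl (s : Fin k) (h : s.val + 1 = k) : s = lastSite k := Fin.ext (by simp [lastSite]; omega)
  rcases lt_trichotomy n 0 with hn | hn | hn
  · by_cases h1 : n = -1
    · subst h1
      norm_num
      field_simp
      simp only [hD, tridiagEntry]
      rw [show (-1 : ℤ) * k + i.val = -(k : ℤ) + i.val by ring] at hs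
      rw [hs]
      split_ifs with h2 h3 h4 h5 h6 h7 <;> first | omega | rw [hl i (by omega)] | rfl
    · have hk : n * k ≤ -2 * k := mul_le_mul_of_nonneg_right (by omega) (by omega)
      rw [if_neg (by omega), if_neg (by omega), if_neg (by omega), tridiagEntry,
        if_neg (by omega), if_neg (by omega), if_neg (by omega)]
      simp
  · subst hn
    norm_num
    field_simp
    simp [hA]
  · by_cases h1 : n = 1
    · subst h1
      norm_num
      field_simp
      simp only [hB, tridiagEntry]
      rw [hs0]
      split_ifs <;> first | omega | rw [hl j (by omega)] | rfl
    · have hk : 2 * k ≤ n * k := mul_le_mul_of_nonneg_right (by omega) (by omega)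
      rw [if_neg (by omega), if_neg (by omega), if_neg (by omega), tridiagEntry,
        if_neg (by omega), if_neg (by omega), if_neg (by omega)]
      simp

theorem tridiagEntry_bound {k : ℕ} [NeZero k] (a b c : Fin k → ℂ) :
    ∃ C : ℝ, 0 ≤ C ∧ ∀ i j, ‖tridiagEntry a b c i j‖ ≤ C := by
  refine ⟨∑ s, ‖a s‖ + ∑ s, ‖b s‖ + ∑ s, ‖c s‖, by positivity, fun i j => ?_⟩
  have h (f : Fin k → ℂ) (s : Fin k) : ‖f s‖ ≤ ∑ s, ‖f s‖ :=
    Finset.single_le_sum (f := fun s => ‖f s‖) (fun _ _ => norm_nonneg _) (Finset.mem_univ s)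
  have h0 (f : Fin k → ℂ) : 0 ≤ ∑ s, ‖f s‖ := by positivity
  have := h0 a; have := h0 b; have := h0 c
  unfold tridiagEntry
  split_ifs
  · linarith [h a (siteIndex k i)]
  · linarith [h b (siteIndex k i)]
  · linarith [h c (siteIndex k j)]
  · simp only [norm_zero]; linarith

/-- A weighted shift of a square-summable sequence is square-summable, with a norm bound. -/
theorem weightedShift_aux (d : ℤ → ℂ) (C : ℝ) (hC : 0 ≤ C) (hd : ∀ n, ‖d n‖ ≤ C) (s : ℤ)
    (x : lp (fun _ : ℤ => ℂ) 2) :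
    ∃ y : lp (fun _ : ℤ => ℂ) 2, (∀ n, y n = d n * x (n + s)) ∧ ‖y‖ ≤ C * ‖x‖ := by
  have h2 : (0 : ℝ) < (2 : ℝ≥0∞).toReal := by norm_num
  have hx : HasSum (fun n => ‖x n‖ ^ (2 : ℝ≥0∞).toReal) (‖x‖ ^ (2 : ℝ≥0∞).toReal) :=
    lp.hasSum_norm h2 x
  have hs : HasSum (fun n => C ^ (2 : ℝ≥0∞).toReal * ‖x (n + s)‖ ^ (2 : ℝ≥0∞).toReal)
      (C ^ (2 : ℝ≥0∞).toReal * ‖x‖ ^ (2 : ℝ≥0∞).toReal) :=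
    ((Equiv.addRight s).hasSum_iff.mpr hx).mul_left _
  have hle (n : ℤ) : ‖d n * x (n + s)‖ ^ (2 : ℝ≥0∞).toReal ≤
      C ^ (2 : ℝ≥0∞).toReal * ‖x (n + s)‖ ^ (2 : ℝ≥0∞).toReal := by
    rw [← Real.mul_rpow hC (norm_nonneg _), norm_mul]
    exact Real.rpow_le_rpow (by positivity)
      (mul_le_mul_of_nonneg_right (hd n) (norm_nonneg _)) h2.le
  have hmem : Memℓp (E := fun _ : ℤ => ℂ) (fun n => d n * x (n + s)) 2 :=
    memℓp_gen (Summable.of_nonneg_of_le (fun n => by positivity) hle hs.summable)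
  refine ⟨⟨_, hmem⟩, fun n => rfl, ?_⟩
  refine lp.norm_le_of_tsum_le h2 (by positivity) ?_
  rw [Real.mul_rpow hC (norm_nonneg _), ← hs.tsum_eq]
  exact Summable.tsum_le_tsum hle
    (Summable.of_nonneg_of_le (fun n => by positivity) hle hs.summable) hs.summable

theorem laurent_aux {k : ℕ} [NeZero k] (a b c : Fin k → ℂ) :
    ∃ C : ℝ, ∀ x : lp (fun _ : ℤ => ℂ) 2, ∃ y : lp (fun _ : ℤ => ℂ) 2,
      (∀ n, y n = ∑ j ∈ Finset.Icc (n - 1) (n + 1), tridiagEntry a b c n j * x j) ∧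
        ‖y‖ ≤ C * ‖x‖ := by
  obtain ⟨C, hC, h⟩ := tridiagEntry_bound a b c
  refine ⟨C + C + C, fun x => ?_⟩
  obtain ⟨u, hu, hu'⟩ :=
    weightedShift_aux (fun n => tridiagEntry a b c n (n + (-1))) C hC (fun n => h _ _) (-1) x
  obtain ⟨v, hv, hv'⟩ :=
    weightedShift_aux (fun n => tridiagEntry a b c n (n + 0)) C hC (fun n => h _ _) 0 x
  obtain ⟨w, hw, hw'⟩ :=
    weightedShift_aux (fun n => tridiagEntry a b c n (n + 1)) C hC (fun n => h _ _) 1 x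
  refine ⟨u + v + w, fun n => ?_, ?_⟩
  · have hI : Finset.Icc (n - 1) (n + 1) = {n + (-1), n + 0, n + 1} := by
      ext j; simp only [Finset.mem_Icc, Finset.mem_insert, Finset.mem_singleton]; omega
    rw [hI, Finset.sum_insert (by simp), Finset.sum_insert (by simp), Finset.sum_singleton,
      lp.coeFn_add, lp.coeFn_add, Pi.add_apply, Pi.add_apply, hu, hv, hw]
    ring
  · have := norm_add₃_le (a := u) (b := v) (c := w)
    linarith

/-- The tridiagonal `k`-Laurent operator `L(a)`: the bounded operator on `ℓ²(ℤ, ℂ)` given by the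
doubly infinite matrix `tridiagEntry a b c`, whose row `n` vanishes outside `n - 1, n, n + 1`. -/
noncomputable def laurentOperator {k : ℕ} [NeZero k] (a b c : Fin k → ℂ) :
    lp (fun _ : ℤ => ℂ) 2 →L[ℂ] lp (fun _ : ℤ => ℂ) 2 :=
  LinearMap.mkContinuousOfExistsBound
    { toFun := fun x =>
        ⟨fun n => ∑ j ∈ Finset.Icc (n - 1) (n + 1), tridiagEntry a b c n j * x j, by
          obtain ⟨C, hC⟩ := laurent_aux a b c
          obtain ⟨y, hy, -⟩ := hC x
          rw [← funext hy]
          exact y.2⟩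
      map_add' := fun x y => by
        ext n
        change ∑ j ∈ Finset.Icc (n - 1) (n + 1), tridiagEntry a b c n j * (x j + y j) =
          ∑ j ∈ Finset.Icc (n - 1) (n + 1), tridiagEntry a b c n j * x j +
          ∑ j ∈ Finset.Icc (n - 1) (n + 1), tridiagEntry a b c n j * y j
        simp only [mul_add, Finset.sum_add_distrib]
      map_smul' := fun r x => by
        ext n
        simp [Finset.mul_sum, mul_left_comm] }
    (by
      obtain ⟨C, hC⟩ := laurent_aux a b c
      refine ⟨C, fun x => ?_⟩
      obtain ⟨y, hy, hy'⟩ := hC x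
      refine le_of_eq_of_le (congrArg norm (lp.ext ?_)) hy'
      exact (funext hy).symm)

theorem laurentOperator_apply {k : ℕ} [NeZero k] (a b c : Fin k → ℂ)
    (x : lp (fun _ : ℤ => ℂ) 2) (n : ℤ) :
    laurentOperator a b c x n =
      ∑ j ∈ Finset.Icc (n - 1) (n + 1), tridiagEntry a b c n j * x j := rfl

/-- The (real, first) Brillouin zone `[-π/ℓ, π/ℓ)` for the spatial period `ℓ`. -/
noncomputable def brillouinZone (ℓ : ℝ) : Set ℝ := Set.Ico (-Real.pi / ℓ) (Real.pi / ℓ)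

/-! The infinite matrix acts on arbitrary sequences and commutes with translation by one cell. By
`mem_spectrum_symbol_iff`, the eigenvalues of a(z) are the μ for which this action has a nonzero
solution of Lx = μx with x(n + k) = z⁻¹x(n). The circulant matrix is the symbol at 1 for a cell of
mk sites, so its eigenvectors are the mk-periodic solutions. Fourier decomposition over ℤ/m splits
these into Bloch solutions with z an m-th root of unity (`spectrum_circulantMatrix`).

For |z| = 1 a Bloch solution is bounded, and damping it by r^|n| with r → 1 gives approximate
eigenvectors in ℓ², so μ ∈ σ(L). Conversely, let U be the unitary shift by one cell. L is the image
of the symbol, read as a matrix over C(σ(U)), under a ring homomorphism. If det(μ - a(z)) has no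
zero on the circle, then μ - L is invertible (`spectrum_laurentOperator_subset`).

Hence the circulant spectra lie inside σ(L). They fill it in the limit because det(μ - a(z)) is
uniformly continuous and factors over the eigenvalues of a(z): a zero at z forces an eigenvalue near
μ at any nearby root of unity. -/

/-! ### Eigenvectors of the symbol as Floquet–Bloch sequences. -/

theorem Matrix.mem_spectrum_iff_exists_mulVec {n : Type*} [Fintype n] [DecidableEq n]
    (A : Matrix n n ℂ) (μ : ℂ) :
    μ ∈ spectrum ℂ A ↔ ∃ v : n → ℂ, v ≠ 0 ∧ A.mulVec v = μ • v := by
  rw [spectrum.mem_iff, Matrix.isUnit_iff_isUnit_det, isUnit_iff_ne_zero, not_not,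
    ← Matrix.exists_mulVec_eq_zero_iff]
  refine exists_congr fun v => and_congr_right fun _ => ?_
  rw [Matrix.sub_mulVec, sub_eq_zero, Algebra.algebraMap_eq_smul_one, Matrix.smul_mulVec,
    Matrix.one_mulVec, eq_comm]

theorem siteIndex_add_mul (k : ℕ) [NeZero k] (n q : ℤ) :
    siteIndex k (n + q * k) = siteIndex k n := by
  apply Fin.ext
  simp [siteIndex]

theorem siteIndex_natCast_val {k : ℕ} [NeZero k] (i : Fin k) : siteIndex k (i.val : ℤ) = i := by
  simpa using siteIndex_block 0 i

theorem ediv_mul_add_siteIndex (k : ℕ) [NeZero k] (n : ℤ) :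
    n = ((siteIndex k n).val : ℤ) + n / k * k := by
  have hk : (k : ℤ) ≠ 0 := by exact_mod_cast NeZero.ne k
  have h1 := Int.emod_nonneg n hk
  have h2 := Int.emod_add_mul_ediv n k
  simp only [siteIndex, Int.toNat_of_nonneg h1]
  linarith [mul_comm (k : ℤ) (n / k)]

/-- The action of the doubly infinite tridiagonal matrix on arbitrary sequences. -/
noncomputable def tridiagAction {k : ℕ} [NeZero k] (a b c : Fin k → ℂ) (y : ℤ → ℂ) (n : ℤ) : ℂ :=
  ∑ j ∈ Finset.Icc (n - 1) (n + 1), tridiagEntry a b c n j * y j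

theorem sum_Icc_sub_one_add_one (f : ℤ → ℂ) (n : ℤ) :
    ∑ j ∈ Finset.Icc (n - 1) (n + 1), f j = f (n - 1) + f n + f (n + 1) := by
  have hI : Finset.Icc (n - 1) (n + 1) = {n - 1, n, n + 1} := by
    ext j; simp only [Finset.mem_Icc, Finset.mem_insert, Finset.mem_singleton]; omega
  rw [hI, Finset.sum_insert (by simp; omega), Finset.sum_insert (by simp), Finset.sum_singleton,
    add_assoc]

theorem tridiagAction_eq {k : ℕ} [NeZero k] (a b c : Fin k → ℂ) (y : ℤ → ℂ) (n : ℤ) :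
    tridiagAction a b c y n = c (siteIndex k (n - 1)) * y (n - 1) + a (siteIndex k n) * y n
      + b (siteIndex k n) * y (n + 1) := by
  rw [tridiagAction, sum_Icc_sub_one_add_one]
  simp only [tridiagEntry]
  rw [if_neg (by omega), if_neg (by omega), if_pos (by omega)]
  simp only [if_true]
  rw [if_neg (by omega)]

theorem tridiagAction_shift {k : ℕ} [NeZero k] (a b c : Fin k → ℂ) (y : ℤ → ℂ) (n q : ℤ) :
    tridiagAction a b c (fun j => y (j + q * k)) n = tridiagAction a b c y (n + q * k) := by
  simp only [tridiagAction_eq, siteIndex_add_mul, add_sub_right_comm _ (q * (k : ℤ)) 1,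
    add_right_comm _ (q * (k : ℤ)) 1]

theorem tridiagAction_const_mul {k : ℕ} [NeZero k] (a b c : Fin k → ℂ) (w : ℂ) (y : ℤ → ℂ)
    (n : ℤ) : tridiagAction a b c (fun j => w * y j) n = w * tridiagAction a b c y n := by
  simp only [tridiagAction_eq]; ring

theorem sum_fin_eq_sum_Icc (k : ℕ) (g : ℤ → ℂ) (i : ℤ)
    (hg : ∀ j, j ∉ Finset.Icc (i - 1) (i + 1) → g j = 0) :
    ∑ j : Fin k, g (j.val : ℤ) =
      ∑ j ∈ Finset.Icc (i - 1) (i + 1), if 0 ≤ j ∧ j < k then g j else 0 := by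
  have h1 : ∑ j : Fin k, g (j.val : ℤ) = ∑ j ∈ Finset.Ico (0 : ℤ) k, g j := by
    refine Finset.sum_bij (fun j _ => (j.val : ℤ)) (fun j _ => by simp)
      (fun i _ j _ h => Fin.ext (by exact_mod_cast h)) (fun j hj => ?_) (fun _ _ => rfl)
    rw [Finset.mem_Ico] at hj
    exact ⟨⟨j.toNat, by omega⟩, Finset.mem_univ _, by simp [hj.1]⟩
  rw [h1, ← Finset.sum_filter]
  refine (Finset.sum_subset (fun j hj => ?_) fun j hj hj' => hg j fun h => hj' ?_).symm
  · simp only [Finset.mem_filter] at hj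
    exact Finset.mem_Ico.2 hj.2
  · exact Finset.mem_filter.2 ⟨h, Finset.mem_Ico.1 hj⟩

theorem lastSite_eq_siteIndex (k : ℕ) [NeZero k] (n : ℤ) (h : n + 1 = k ∨ n = -1) :
    siteIndex k n = lastSite k := by
  have hk := Nat.pos_of_ne_zero (NeZero.ne k)
  have h0 : siteIndex k n = siteIndex k ((lastSite k).val : ℤ) := by
    have h1 : ((lastSite k).val : ℤ) = k - 1 := by simp only [lastSite]; omega
    rcases h with h | h
    · congr 1; omega
    · rw [h1, ← siteIndex_add_mul k n 1]; congr 1; omega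
  rw [h0, siteIndex_natCast_val]

/-- One block row of the tridiagonal matrix, split into the three blocks that meet it. -/
theorem sum_block_eq_tridiagAction {k : ℕ} [NeZero k] (a b c : Fin k → ℂ) (y : ℤ → ℂ)
    (i : Fin k) :
    ∑ j : Fin k, (tridiagEntry a b c (i.val : ℤ) (j.val : ℤ) * y j.val
      + (if i.val = 0 ∧ j.val + 1 = k then c (lastSite k) * y (j.val - k) else 0)
      + (if i.val + 1 = k ∧ j.val = 0 then b (lastSite k) * y (j.val + k) else 0)) =
    tridiagAction a b c y i.val := by
  have hk := Nat.pos_of_ne_zero (NeZero.ne k)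
  have hi := i.isLt
  have hc : ∑ j : Fin k, (if i.val = 0 ∧ j.val + 1 = k then
      c (lastSite k) * y (j.val - k) else 0) =
      if i.val = 0 then c (lastSite k) * y (-1) else 0 := by
    rw [Finset.sum_eq_single (lastSite k)]
    · have h1 : (lastSite k).val + 1 = k := by simp only [lastSite]; omega
      simp only [h1, and_true]
      rw [show (((lastSite k).val : ℤ) - k) = -1 by omega]
    · intro j _ hj
      refine if_neg fun h => hj (Fin.ext ?_)
      simp only [lastSite]; omega
    · simp
  have hb : ∑ j : Fin k, (if i.val + 1 = k ∧ j.val = 0 then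
      b (lastSite k) * y (j.val + k) else 0) =
      if i.val + 1 = k then b (lastSite k) * y k else 0 := by
    rw [Finset.sum_eq_single ⟨0, hk⟩]
    · simp
    · intro j _ hj
      exact if_neg fun h => hj (Fin.ext h.2)
    · simp
  rw [Finset.sum_add_distrib, Finset.sum_add_distrib, hc, hb,
    sum_fin_eq_sum_Icc k (fun j => tridiagEntry a b c (i.val : ℤ) j * y j) i.val,
    sum_Icc_sub_one_add_one, tridiagAction, sum_Icc_sub_one_add_one]
  -- The corner terms are exactly the neighbours of site i that fall outside the cell. Since they
  -- are added, the cases k = 1 and k = 2 need no separate treatment.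
  · have e1 : (if i.val = 0 then c (lastSite k) * y (-1) else 0) =
        if (0 : ℤ) ≤ i.val - 1 ∧ (i.val - 1 : ℤ) < k then 0 else
          tridiagEntry a b c (i.val : ℤ) (i.val - 1) * y (i.val - 1) := by
      by_cases h : i.val = 0
      · rw [if_pos h, if_neg (by omega), tridiagEntry, if_neg (by omega), if_neg (by omega),
          if_pos (by omega), lastSite_eq_siteIndex k _ (Or.inr (by omega)), h]
        norm_num
      · rw [if_neg h, if_pos (by omega)]
    have e2 : (if i.val + 1 = k then b (lastSite k) * y k else 0) =
        if (0 : ℤ) ≤ i.val + 1 ∧ (i.val + 1 : ℤ) < k then 0 else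
          tridiagEntry a b c (i.val : ℤ) (i.val + 1) * y (i.val + 1) := by
      by_cases h : i.val + 1 = k
      · rw [if_pos h, if_neg (by omega), tridiagEntry, if_neg (by omega), if_pos (by omega),
          lastSite_eq_siteIndex k _ (Or.inl (by omega)), show ((i.val : ℤ) + 1) = k by omega]
      · rw [if_neg h, if_pos (by omega)]
    rw [e1, e2, if_pos (show (0 : ℤ) ≤ i.val ∧ (i.val : ℤ) < k by omega)]
    split_ifs <;> ring
  · intro j hj
    rw [Finset.mem_Icc] at hj
    rw [tridiagEntry, if_neg (by omega), if_neg (by omega), if_neg (by omega), zero_mul]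

theorem apply_add_mul_of_quasiperiodic {x : ℤ → ℂ} {w : ℂ} (hw : w ≠ 0) {p : ℤ}
    (hx : ∀ n, x (n + p) = w * x n) (n q : ℤ) : x (n + q * p) = w ^ q * x n := by
  induction q using Int.induction_on with
  | zero => simp
  | succ r ih => rw [add_mul, one_mul, ← add_assoc, hx, ih, zpow_add_one₀ hw]; ring
  | pred r ih =>
    have h := hx (n + (-(r : ℤ) - 1) * p)
    rw [show n + (-(r : ℤ) - 1) * p + p = n + -(r : ℤ) * p by ring, ih] at h
    rw [zpow_sub_one₀ hw, mul_right_comm, h]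
    field_simp

/-- The corner factors z and z⁻¹ turn values in the cell into x(j - k) and x(j + k), the values in
the two adjacent cells. -/
theorem symbol_mulVec_apply {k : ℕ} [NeZero k] (a b c : Fin k → ℂ) {z : ℂ} (hz : z ≠ 0)
    {x : ℤ → ℂ} (hx : ∀ n, x (n + k) = z⁻¹ * x n) (i : Fin k) :
    (symbol a b c z).mulVec (fun j => x j.val) i = tridiagAction a b c x i.val := by
  rw [← sum_block_eq_tridiagAction, Matrix.mulVec, dotProduct]
  refine Finset.sum_congr rfl fun j _ => ?_
  have h : x (j.val - k) = z * x j.val := by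
    have := hx (j.val - k)
    rw [sub_add_cancel] at this
    rw [this, mul_inv_cancel_left₀ hz]
  rw [hx, h]
  simp only [symbol, Matrix.of_apply, add_mul, ite_mul, zero_mul, mul_assoc]

/-- Floquet–Bloch description of the spectrum of the symbol. -/
theorem mem_spectrum_symbol_iff {k : ℕ} [NeZero k] (a b c : Fin k → ℂ) {z : ℂ} (hz : z ≠ 0)
    (μ : ℂ) :
    μ ∈ spectrum ℂ (symbol a b c z) ↔ ∃ x : ℤ → ℂ, x ≠ 0 ∧ (∀ n, x (n + k) = z⁻¹ * x n) ∧
      ∀ n, tridiagAction a b c x n = μ * x n := by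
  have hz' : z⁻¹ ≠ 0 := inv_ne_zero hz
  have hk : (k : ℤ) ≠ 0 := by exact_mod_cast NeZero.ne k
  rw [Matrix.mem_spectrum_iff_exists_mulVec]
  constructor
  · rintro ⟨v, hv, hv'⟩
    -- The eigenvector fills cell 0 and picks up a factor z⁻¹ from each cell to the next.
    set x : ℤ → ℂ := fun n => z⁻¹ ^ (n / k) * v (siteIndex k n) with hxdef
    have hxv (i : Fin k) : x i.val = v i := by
      simp only [hxdef, siteIndex_natCast_val]
      rw [Int.ediv_eq_zero_of_lt (by omega) (by omega), zpow_zero, one_mul]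
    have hx (n : ℤ) : x (n + k) = z⁻¹ * x n := by
      have := siteIndex_add_mul k n 1
      rw [one_mul] at this
      simp only [hxdef, this]
      rw [Int.add_ediv_of_dvd_right dvd_rfl, Int.ediv_self hk, zpow_add_one₀ hz']
      ring
    refine ⟨x, fun h => hv ?_, hx, fun n => ?_⟩
    · ext i
      rw [← hxv, h]; rfl
    -- By translation invariance, the equation at n reduces to the one at the same position in cell
    -- 0.
    · have h := congrFun hv' (siteIndex k n)
      rw [← funext hxv, symbol_mulVec_apply a b c hz hx] at h
      simp only [Pi.smul_apply, smul_eq_mul] at h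
      rw [ediv_mul_add_siteIndex k n, ← tridiagAction_shift,
        apply_add_mul_of_quasiperiodic hz' hx]
      simp only [apply_add_mul_of_quasiperiodic hz' hx]
      rw [tridiagAction_const_mul, h]
      ring
  · rintro ⟨x, hx0, hx, hμ⟩
    refine ⟨fun j => x j.val, fun h => hx0 ?_, ?_⟩
    · ext n
      rw [ediv_mul_add_siteIndex k n, apply_add_mul_of_quasiperiodic hz' hx]
      have := congrFun h (siteIndex k n)
      simp only [Pi.zero_apply] at this
      rw [this, mul_zero]; rfl
    · ext i
      rw [symbol_mulVec_apply a b c hz hx, hμ]; rfl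

/-! ### Spectra of the circulant matrices. -/

theorem siteIndex_siteIndex_mul (m k : ℕ) [NeZero k] [NeZero (m * k)] (n : ℤ) :
    siteIndex k ((siteIndex (m * k) n).val : ℤ) = siteIndex k n := by
  conv_rhs => rw [ediv_mul_add_siteIndex (m * k) n]
  rw [Nat.cast_mul, ← mul_assoc, siteIndex_add_mul]

theorem tridiagEntry_mul_period {k : ℕ} [NeZero k] (a b c : Fin k → ℂ) (m : ℕ)
    [NeZero (m * k)] (i j : ℤ) :
    tridiagEntry (k := m * k) (fun s => a (siteIndex k s.val)) (fun s => b (siteIndex k s.val))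
      (fun s => c (siteIndex k s.val)) i j = tridiagEntry a b c i j := by
  simp only [tridiagEntry, siteIndex_siteIndex_mul]

/-- The circulant matrix is the symbol at `1` for the unit cell of `m * k` sites. -/
theorem circulantMatrix_eq_symbol {k : ℕ} [NeZero k] (a b c : Fin k → ℂ) (m : ℕ)
    [NeZero (m * k)] :
    circulantMatrix a b c m = symbol (k := m * k) (fun s => a (siteIndex k s.val))
      (fun s => b (siteIndex k s.val)) (fun s => c (siteIndex k s.val)) 1 := by
  have hl : siteIndex k ((lastSite (m * k)).val : ℤ) = lastSite k := by
    rw [← lastSite_eq_siteIndex (m * k) (-1) (Or.inr rfl), siteIndex_siteIndex_mul,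
      lastSite_eq_siteIndex k (-1) (Or.inr rfl)]
  ext i j
  simp only [circulantMatrix, symbol, toeplitzMatrix, Matrix.of_apply, tridiagEntry_mul_period, hl,
    mul_one, inv_one]

/-- For a cell of m * k sites and z = 1 the Bloch condition is m * k-periodicity. -/
theorem mem_spectrum_circulantMatrix_iff {k : ℕ} [NeZero k] (a b c : Fin k → ℂ) {m : ℕ}
    (hm : 0 < m) (μ : ℂ) :
    μ ∈ spectrum ℂ (circulantMatrix a b c m) ↔ ∃ x : ℤ → ℂ, x ≠ 0 ∧
      (∀ n, x (n + m * k) = x n) ∧ ∀ n, tridiagAction a b c x n = μ * x n := by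
  have : NeZero (m * k) := ⟨mul_ne_zero hm.ne' (NeZero.ne k)⟩
  rw [circulantMatrix_eq_symbol, mem_spectrum_symbol_iff _ _ _ one_ne_zero]
  simp only [tridiagAction, tridiagEntry_mul_period, Nat.cast_mul, inv_one, one_mul]

theorem sum_range_shift_of_periodic (h : ℕ → ℂ) (m : ℕ) (hm : h m = h 0) :
    ∑ r ∈ Finset.range m, h (r + 1) = ∑ r ∈ Finset.range m, h r := by
  have h1 := Finset.sum_range_succ h m
  have h2 := Finset.sum_range_succ' h m
  rw [h1, hm] at h2
  exact (add_right_cancel h2).symm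

/-- Orthogonality of characters of ℤ/m: summing over j kills every term except r = 0. -/
theorem sum_rootsOfUnity_average {ζ : ℂ} {m : ℕ} (hζ : IsPrimitiveRoot ζ m) (hm : 0 < m)
    (f : ℕ → ℂ) :
    ∑ j ∈ Finset.range m, ∑ r ∈ Finset.range m, (ζ ^ j) ^ r * f r = m * f 0 := by
  rw [Finset.sum_comm, Finset.sum_eq_single 0]
  · simp
  · intro r hr hr0
    have h1 : ζ ^ r ≠ 1 := hζ.pow_ne_one_of_pos_of_lt hr0 (Finset.mem_range.1 hr)
    have h2 : ∑ j ∈ Finset.range m, (ζ ^ r) ^ j = 0 := by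
      rw [geom_sum_eq h1, ← pow_mul, mul_comm r m, pow_mul, hζ.pow_eq_one, one_pow, sub_self,
        zero_div]
    rw [← Finset.sum_mul]
    simp_rw [← pow_mul, mul_comm _ r, pow_mul, h2, zero_mul]
  · simp [hm.ne']

theorem spectrum_circulantMatrix {k : ℕ} [NeZero k] (a b c : Fin k → ℂ) {m : ℕ} (hm : 0 < m) :
    spectrum ℂ (circulantMatrix a b c m) =
      ⋃ j ∈ Finset.range m,
        spectrum ℂ (symbol a b c (Complex.exp (2 * Real.pi * Complex.I * j / m))) := by
  have hζ := Complex.isPrimitiveRoot_exp m hm.ne'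
  set ζ := Complex.exp (2 * Real.pi * Complex.I / m) with hζdef
  have hexp (j : ℕ) : Complex.exp (2 * Real.pi * Complex.I * j / m) = ζ ^ j := by
    rw [hζdef, ← Complex.exp_nat_mul]; congr 1; ring
  have hζ0 : ζ ≠ 0 := Complex.exp_ne_zero _
  ext μ
  simp only [Set.mem_iUnion, hexp, exists_prop, mem_spectrum_circulantMatrix_iff a b c hm,
    mem_spectrum_symbol_iff a b c (pow_ne_zero _ hζ0)]
  constructor
  · rintro ⟨x, hx0, hx, hμ⟩
    obtain ⟨n₀, hn₀⟩ := Function.ne_iff.1 hx0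
    -- The Fourier components at n₀ add up to m * x n₀ ≠ 0, so some component is nonzero. That
    -- component is the Bloch solution sought.
    have hsum := sum_rootsOfUnity_average hζ hm fun r => x (n₀ + r * k)
    have hne : (m : ℂ) * x (n₀ + (0 : ℕ) * k) ≠ 0 := by
      simpa [hm.ne'] using hn₀
    rw [← hsum] at hne
    obtain ⟨j, hj, hj'⟩ := Finset.exists_ne_zero_of_sum_ne_zero hne
    have hw := pow_ne_zero j hζ0
    have hwm : (ζ ^ j) ^ m = 1 := by rw [← pow_mul, mul_comm, pow_mul, hζ.pow_eq_one, one_pow]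
    refine ⟨j, hj, fun n => ∑ r ∈ Finset.range m, (ζ ^ j) ^ r * x (n + r * k),
      fun h => hj' (congrFun h n₀), fun n => ?_, fun n => ?_⟩
    · have := sum_range_shift_of_periodic (fun r => (ζ ^ j) ^ r * x (n + r * k)) m
        (by simp [hwm, hx])
      simp only [← this, Finset.mul_sum]
      refine Finset.sum_congr rfl fun r _ => ?_
      rw [show n + k + (r : ℤ) * k = n + ((r + 1 : ℕ) : ℤ) * k by push_cast; ring]
      rw [pow_succ]
      field_simp
    · have h (r : ℕ) := hμ (n + r * k)
      simp only [← tridiagAction_shift] at h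
      simp only [tridiagAction_eq] at h ⊢
      simp only [Finset.mul_sum, ← Finset.sum_add_distrib]
      refine Finset.sum_congr rfl fun r _ => ?_
      linear_combination (ζ ^ j) ^ r * h r
  · rintro ⟨j, -, x, hx0, hx, hμ⟩
    refine ⟨x, hx0, fun n => ?_, hμ⟩
    rw [apply_add_mul_of_quasiperiodic (inv_ne_zero (pow_ne_zero j hζ0)) hx n m, zpow_natCast,
      inv_pow, ← pow_mul, mul_comm j m, pow_mul, hζ.pow_eq_one, one_pow, inv_one, one_mul]

/-! ### Symbol spectra on the unit circle lie in the Laurent spectrum. -/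

theorem memℓp_two_mul_pow_natAbs {x : ℤ → ℂ} {M : ℝ} (hM : ∀ n, ‖x n‖ ≤ M) {r : ℝ}
    (hr0 : 0 ≤ r) (hr1 : r < 1) :
    Memℓp (E := fun _ : ℤ => ℂ) (fun n => x n * ((r ^ n.natAbs : ℝ) : ℂ)) 2 := by
  have hr2 : r ^ 2 < 1 := pow_lt_one₀ hr0 hr1 two_ne_zero
  have hs : Summable fun n : ℤ => M ^ 2 * (r ^ 2) ^ n.natAbs := by
    refine Summable.mul_left _ (Summable.of_nat_of_neg ?_ ?_) <;>
    simpa using summable_geometric_of_lt_one (sq_nonneg r) hr2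
  refine memℓp_gen (Summable.of_nonneg_of_le (fun n => by positivity) (fun n => ?_) hs)
  rw [ENNReal.toReal_ofNat, Real.rpow_two, norm_mul, Complex.norm_real, mul_pow,
    Real.norm_of_nonneg (by positivity), ← pow_mul, ← pow_mul, mul_comm 2]
  gcongr
  exact hM n

/-- Neighbouring damping weights have ratio r or r⁻¹; the larger deviation from 1 is r⁻¹ - 1. -/
theorem exists_pow_natAbs_eq_mul {r : ℝ} (hr0 : 0 < r) (hr1 : r ≤ 1) (n m : ℤ)
    (h : m = n + 1 ∨ n = m + 1) :
    ∃ q : ℝ, r ^ n.natAbs = q * r ^ m.natAbs ∧ ‖((1 - q : ℝ) : ℂ)‖ ≤ r⁻¹ - 1 := by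
  have h1 : 1 ≤ r⁻¹ := (one_le_inv₀ hr0).2 hr1
  have h2 : 1 - r ≤ r⁻¹ - 1 := by
    have := mul_inv_cancel₀ hr0.ne'
    nlinarith [mul_nonneg (sub_nonneg.2 hr1) (sub_nonneg.2 h1)]
  simp only [Complex.norm_real, Real.norm_eq_abs]
  have h3 : n.natAbs = m.natAbs + 1 ∨ m.natAbs = n.natAbs + 1 := by omega
  rcases h3 with h3 | h3
  · exact ⟨r, by rw [h3, pow_succ'], by rw [abs_of_nonneg (by linarith)]; exact h2⟩
  · refine ⟨r⁻¹, by rw [h3, pow_succ', inv_mul_cancel_left₀ hr0.ne'], ?_⟩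
    rw [abs_of_nonpos (by linarith)]; linarith

/-- Damping a bounded generalized eigenvector geometrically makes it an approximate eigenvector of
the Laurent operator. -/
theorem exists_approx_eigenvector {k : ℕ} [NeZero k] (a b c : Fin k → ℂ) :
    ∃ C : ℝ, 0 ≤ C ∧ ∀ (x : ℤ → ℂ) (μ : ℂ) (M : ℝ), x ≠ 0 → (∀ n, ‖x n‖ ≤ M) →
      (∀ n, tridiagAction a b c x n = μ * x n) → ∀ r : ℝ, 0 < r → r < 1 →
      ∃ u : lp (fun _ : ℤ => ℂ) 2, u ≠ 0 ∧
        ‖μ • u - laurentOperator a b c u‖ ≤ C * (r⁻¹ - 1) * ‖u‖ := by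
  obtain ⟨C, hC, hbd⟩ := tridiagEntry_bound a b c
  refine ⟨C + C, by positivity, fun x μ M hx0 hM hμ r hr0 hr1 => ?_⟩
  have hδ : 0 ≤ r⁻¹ - 1 := sub_nonneg.2 ((one_le_inv₀ hr0).2 hr1.le)
  set u : lp (fun _ : ℤ => ℂ) 2 := ⟨_, memℓp_two_mul_pow_natAbs hM hr0.le hr1⟩ with hu
  have hun (n : ℤ) : u n = x n * ((r ^ n.natAbs : ℝ) : ℂ) := rfl
  choose p hp hp' using fun n : ℤ =>
    exists_pow_natAbs_eq_mul hr0 hr1.le n (n + (-1)) (Or.inr (by ring))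
  choose q hq hq' using fun n : ℤ => exists_pow_natAbs_eq_mul hr0 hr1.le n (n + 1) (Or.inl rfl)
  obtain ⟨v, hv, hv'⟩ := weightedShift_aux
    (fun n => -(tridiagEntry a b c n (n + (-1)) * ((1 - p n : ℝ) : ℂ))) (C * (r⁻¹ - 1))
    (by positivity) (fun n => by
      rw [norm_neg, norm_mul]; exact mul_le_mul (hbd _ _) (hp' n) (norm_nonneg _) hC) (-1) u
  obtain ⟨w, hw, hw'⟩ := weightedShift_aux
    (fun n => -(tridiagEntry a b c n (n + 1) * ((1 - q n : ℝ) : ℂ))) (C * (r⁻¹ - 1))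
    (by positivity) (fun n => by
      rw [norm_neg, norm_mul]; exact mul_le_mul (hbd _ _) (hq' n) (norm_nonneg _) hC) 1 u
  refine ⟨u, fun h => hx0 ?_, ?_⟩
  · ext n
    have h1 : u n = 0 := by rw [h]; rfl
    rw [hun] at h1
    have h2 : ((r ^ n.natAbs : ℝ) : ℂ) ≠ 0 := by exact_mod_cast (pow_pos hr0 _).ne'
    exact (mul_eq_zero.1 h1).resolve_right h2
  -- Multiplying the eigenvalue equation by the weight at n cancels the diagonal term. Only
  -- differences of neighbouring weights remain, as two weighted shifts of u.
  · have hsum : μ • u - laurentOperator a b c u = v + w := by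
      ext n
      have h1 : (μ • u - laurentOperator a b c u) n = μ * u n - laurentOperator a b c u n := rfl
      have h2 : (v + w) n = v n + w n := rfl
      have h3 := hμ n
      have h4 : ((r ^ n.natAbs : ℝ) : ℂ) = p n * ((r ^ (n + (-1)).natAbs : ℝ) : ℂ) := by
        exact_mod_cast hp n
      have h5 : ((r ^ n.natAbs : ℝ) : ℂ) = q n * ((r ^ (n + 1).natAbs : ℝ) : ℂ) := by
        exact_mod_cast hq n
      rw [h1, h2, laurentOperator_apply, sum_Icc_sub_one_add_one, hv, hw]
      rw [tridiagAction, sum_Icc_sub_one_add_one] at h3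
      simp only [hun, sub_eq_add_neg n 1, Complex.ofReal_sub, Complex.ofReal_one] at h3 ⊢
      linear_combination -((r ^ n.natAbs : ℝ) : ℂ) * h3
        + tridiagEntry a b c n (n + (-1)) * x (n + (-1)) * h4
        + tridiagEntry a b c n (n + 1) * x (n + 1) * h5
    rw [hsum]
    refine (norm_add_le v w).trans ?_
    linarith

theorem mem_spectrum_laurentOperator_of_bounded {k : ℕ} [NeZero k] (a b c : Fin k → ℂ)
    {x : ℤ → ℂ} {μ : ℂ} {M : ℝ} (hx0 : x ≠ 0) (hM : ∀ n, ‖x n‖ ≤ M)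
    (hμ : ∀ n, tridiagAction a b c x n = μ * x n) : μ ∈ spectrum ℂ (laurentOperator a b c) := by
  obtain ⟨C, hC, h⟩ := exists_approx_eigenvector a b c
  rw [spectrum.mem_iff]
  intro hunit
  obtain ⟨R, hR⟩ := hunit.exists_left_inv
  -- With r = (1 + δ)⁻¹ the defect is at most C * δ * ‖u‖. This δ makes ‖R‖ * C * δ < 1,
  -- contradicting R(μu - Lu) = u.
  set δ : ℝ := 1 / (‖R‖ * C + 1) with hδ
  have hpos : 0 < ‖R‖ * C + 1 := by positivity
  have hδ0 : 0 < δ := by positivity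
  obtain ⟨u, hu0, hu⟩ := h x μ M hx0 hM hμ (1 + δ)⁻¹ (by positivity)
    (inv_lt_one_of_one_lt₀ (by linarith))
  have hRu : R (μ • u - laurentOperator a b c u) = u := by
    have := congrArg (fun T => T u) hR
    simpa [Algebra.algebraMap_eq_smul_one] using this
  have h1 : ‖u‖ ≤ ‖R‖ * (C * δ * ‖u‖) := by
    calc ‖u‖ = ‖R (μ • u - laurentOperator a b c u)‖ := by rw [hRu]
      _ ≤ ‖R‖ * ‖μ • u - laurentOperator a b c u‖ := R.le_opNorm _
      _ ≤ ‖R‖ * (C * δ * ‖u‖) := by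
        refine mul_le_mul_of_nonneg_left (hu.trans_eq ?_) (norm_nonneg _)
        rw [inv_inv]; ring
  have h2 : ‖R‖ * C * δ < 1 := by
    rw [hδ, mul_one_div, div_lt_one hpos]; linarith
  have h3 : 0 < ‖u‖ := norm_pos_iff.2 hu0
  nlinarith

theorem spectrum_symbol_subset_spectrum_laurentOperator {k : ℕ} [NeZero k] (a b c : Fin k → ℂ)
    {z : ℂ} (hz : ‖z‖ = 1) :
    spectrum ℂ (symbol a b c z) ⊆ spectrum ℂ (laurentOperator a b c) := by
  intro μ hμ
  have hz0 : z ≠ 0 := norm_ne_zero_iff.1 (by rw [hz]; exact one_ne_zero)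
  obtain ⟨x, hx0, hx, hμ⟩ := (mem_spectrum_symbol_iff a b c hz0 μ).1 hμ
  refine mem_spectrum_laurentOperator_of_bounded a b c (M := ∑ i : Fin k, ‖x i.val‖) hx0
    (fun n => ?_) hμ
  rw [ediv_mul_add_siteIndex k n, apply_add_mul_of_quasiperiodic (inv_ne_zero hz0) hx, norm_mul,
    norm_zpow, norm_inv, hz, inv_one, one_zpow, one_mul]
  exact Finset.single_le_sum (f := fun i : Fin k => ‖x i.val‖) (fun _ _ => norm_nonneg _)
    (Finset.mem_univ (siteIndex k n))

/-! ### The Laurent operator as a matrix over the functional calculus of the cell shift. -/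

/-- The operator `x ↦ (d n * x (n + s))ₙ` on `ℓ²(ℤ)` for a bounded weight `d`. -/
noncomputable def weightedShift (d : ℤ → ℂ) (hd : ∃ C : ℝ, ∀ n, ‖d n‖ ≤ C) (s : ℤ) :
    lp (fun _ : ℤ => ℂ) 2 →L[ℂ] lp (fun _ : ℤ => ℂ) 2 :=
  LinearMap.mkContinuousOfExistsBound
    { toFun := fun x => ⟨fun n => d n * x (n + s), by
        obtain ⟨C, hC⟩ := hd
        obtain ⟨y, hy, -⟩ := weightedShift_aux d C ((norm_nonneg _).trans (hC 0)) hC s x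
        rw [← funext hy]
        exact y.2⟩
      map_add' := fun x y => by
        ext n
        exact mul_add (d n) (x (n + s)) (y (n + s))
      map_smul' := fun r x => by
        ext n
        exact mul_left_comm (d n) r (x (n + s)) }
    (by
      obtain ⟨C, hC⟩ := hd
      refine ⟨C, fun x => ?_⟩
      obtain ⟨y, hy, hy'⟩ := weightedShift_aux d C ((norm_nonneg _).trans (hC 0)) hC s x
      exact le_of_eq_of_le (congrArg norm (lp.ext (funext hy).symm)) hy')

theorem weightedShift_apply (d : ℤ → ℂ) (hd : ∃ C : ℝ, ∀ n, ‖d n‖ ≤ C) (s : ℤ)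
    (x : lp (fun _ : ℤ => ℂ) 2) (n : ℤ) : weightedShift d hd s x n = d n * x (n + s) := rfl

/-- The bilateral shift `x ↦ (x (n + s))ₙ`. -/
noncomputable def bilateralShift (s : ℤ) :
    lp (fun _ : ℤ => ℂ) 2 →L[ℂ] lp (fun _ : ℤ => ℂ) 2 :=
  weightedShift (fun _ => 1) ⟨1, fun _ => by simp⟩ s

theorem bilateralShift_apply (s : ℤ) (x : lp (fun _ : ℤ => ℂ) 2) (n : ℤ) :
    bilateralShift s x n = x (n + s) := one_mul _

theorem star_bilateralShift (s : ℤ) : star (bilateralShift s) = bilateralShift (-s) := by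
  rw [ContinuousLinearMap.star_eq_adjoint, eq_comm, ContinuousLinearMap.eq_adjoint_iff]
  intro x y
  rw [lp.inner_eq_tsum, lp.inner_eq_tsum, ← (Equiv.addRight s).tsum_eq]
  simp [bilateralShift_apply]

theorem bilateralShift_mem_unitary (s : ℤ) : bilateralShift s ∈ unitary
    (lp (fun _ : ℤ => ℂ) 2 →L[ℂ] lp (fun _ : ℤ => ℂ) 2) := by
  rw [Unitary.mem_iff, star_bilateralShift]
  constructor <;>
  · ext x n
    simp [bilateralShift_apply]

/-- The matrix unit `(i, j)` acting on every unit cell of `ℓ²(ℤ)`. -/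
noncomputable def cellUnit {k : ℕ} [NeZero k] (i j : Fin k) :
    lp (fun _ : ℤ => ℂ) 2 →L[ℂ] lp (fun _ : ℤ => ℂ) 2 :=
  weightedShift (fun n => if siteIndex k n = i then 1 else 0)
    ⟨1, fun n => by split_ifs <;> simp⟩ (j.val - i.val)

theorem cellUnit_apply {k : ℕ} [NeZero k] (i j : Fin k) (x : lp (fun _ : ℤ => ℂ) 2) (n : ℤ) :
    cellUnit i j x n = if siteIndex k n = i then x (n + (j.val - i.val)) else 0 := by
  rw [cellUnit, weightedShift_apply, ite_mul, one_mul, zero_mul]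

theorem siteIndex_add_sub {k : ℕ} [NeZero k] (i j : Fin k) {n : ℤ} (h : siteIndex k n = i) :
    siteIndex k (n + (j.val - i.val)) = j := by
  have hn := ediv_mul_add_siteIndex k n
  rw [h] at hn
  rw [show n + ((j.val : ℤ) - i.val) = j.val + n / k * k by linarith, siteIndex_add_mul,
    siteIndex_natCast_val]

/-- `cellUnit i j` reads position j of the same cell and writes it at position i, so the usual
matrix-unit relations hold. -/
theorem cellUnit_mul {k : ℕ} [NeZero k] (i j i' j' : Fin k) :
    cellUnit i j * cellUnit i' j' = if j = i' then cellUnit i j' else 0 := by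
  ext x n
  rw [mul_apply_eq_comp, cellUnit_apply]
  by_cases h : siteIndex k n = i
  · rw [if_pos h, cellUnit_apply, siteIndex_add_sub i j h]
    by_cases hj : j = i'
    · subst hj
      rw [if_pos rfl, if_pos rfl, cellUnit_apply, if_pos h]
      exact congrArg (x : ℤ → ℂ) (by ring)
    · rw [if_neg hj, if_neg hj]; rfl
  · rw [if_neg h]
    split_ifs
    · rw [cellUnit_apply, if_neg h]
    · rfl

theorem lp_sum_apply {ι : Type*} (s : Finset ι)
    (T : ι → lp (fun _ : ℤ => ℂ) 2 →L[ℂ] lp (fun _ : ℤ => ℂ) 2) (x : lp (fun _ : ℤ => ℂ) 2)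
    (n : ℤ) : (∑ i ∈ s, T i) x n = ∑ i ∈ s, T i x n := by
  rw [_root_.sum_apply, lp.coeFn_sum, Finset.sum_apply]

theorem sum_cellUnit (k : ℕ) [NeZero k] : ∑ i : Fin k, cellUnit i i = 1 := by
  ext x n
  rw [lp_sum_apply]
  simp [cellUnit_apply]

theorem bilateralShift_commute_cellUnit {k : ℕ} [NeZero k] (q : ℤ) (i j : Fin k) :
    Commute (bilateralShift (q * k)) (cellUnit i j) := by
  ext x n
  simp only [mul_apply_eq_comp, bilateralShift_apply, cellUnit_apply,
    siteIndex_add_mul]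
  rw [add_right_comm]

/-- The ring homomorphism from matrices given by a system of matrix units that commutes with the
image of the coefficient ring. -/
def Matrix.liftOfUnits {n R B : Type*} [Fintype n] [DecidableEq n] [Ring R] [Ring B]
    (φ : R →+* B) (E : n → n → B)
    (hE : ∀ i j i' j', E i j * E i' j' = if j = i' then E i j' else 0)
    (hE1 : ∑ i, E i i = 1) (hφ : ∀ r i j, Commute (φ r) (E i j)) : Matrix n n R →+* B where
  toFun A := ∑ i, ∑ j, φ (A i j) * E i j
  map_zero' := by simp
  map_add' A B := by simp [add_mul, Finset.sum_add_distrib]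
  map_one' := by
    rw [← hE1]
    refine Finset.sum_congr rfl fun i _ => ?_
    rw [Finset.sum_eq_single i]
    · simp
    · intro j _ hj; simp [Matrix.one_apply_ne hj.symm]
    · simp
  map_mul' A B := by
    have h (i j i' j' : n) : φ (A i j) * E i j * (φ (B i' j') * E i' j') =
        if j = i' then φ (A i j * B i' j') * E i j' else 0 := by
      rw [mul_assoc, ← mul_assoc (E i j), ← (hφ (B i' j') i j).eq, mul_assoc (φ (B i' j')), hE,
        map_mul]
      split_ifs <;> simp [mul_assoc]
    rw [Finset.sum_mul]
    refine Finset.sum_congr rfl fun i _ => ?_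
    simp only [Matrix.mul_apply, map_sum, Finset.sum_mul]
    rw [Finset.sum_comm]
    refine Finset.sum_congr rfl fun j _ => ?_
    simp only [Finset.mul_sum, h]
    rw [Finset.sum_comm]
    simp

/-- Off the spectra of the symbol on the unit circle the Laurent operator has a resolvent. -/
theorem spectrum_laurentOperator_subset {k : ℕ} [NeZero k] (a b c : Fin k → ℂ) {μ : ℂ}
    (hμ : μ ∈ spectrum ℂ (laurentOperator a b c)) :
    ∃ z : ℂ, ‖z‖ = 1 ∧ μ ∈ spectrum ℂ (symbol a b c z) := by
  by_contra! hcon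
  refine hμ ?_
  -- The sign is chosen so that Bloch sequences satisfy x(n - k) = z x(n): U plays the role of z and
  -- its adjoint that of z⁻¹.
  set U := bilateralShift (-(1 : ℤ) * k) with hUdef
  have hUu : U ∈ unitary _ := bilateralShift_mem_unitary _
  have hU : IsStarNormal U := ⟨(Unitary.star_mul_self_of_mem hUu).trans
    (Unitary.mul_star_self_of_mem hUu).symm⟩
  have hUs : star U = bilateralShift ((1 : ℤ) * k) := by
    rw [hUdef, star_bilateralShift]; congr 1; ring
  let ι : C(spectrum ℂ U, ℂ) := ContinuousMap.restrict (spectrum ℂ U) (ContinuousMap.id ℂ)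
  let φ : C(spectrum ℂ U, ℂ) →⋆ₐ[ℂ] (lp (fun _ : ℤ => ℂ) 2 →L[ℂ] lp (fun _ : ℤ => ℂ) 2) :=
    cfcHom hU
  have hφι : φ ι = U := cfcHom_id hU
  have hcomm (f : C(spectrum ℂ U, ℂ)) (i j : Fin k) : Commute (φ f) (cellUnit i j) :=
    Commute.cfcHom hU (bilateralShift_commute_cellUnit _ i j)
      (by rw [hUs]; exact bilateralShift_commute_cellUnit _ i j) f
  let Ψ := Matrix.liftOfUnits (φ : C(spectrum ℂ U, ℂ) →+* _) cellUnit cellUnit_mul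
    (sum_cellUnit k) hcomm
  -- The symbol with z as the coordinate function; conjugation replaces inversion, which is the same
  -- on the unit circle.
  let A : Matrix (Fin k) (Fin k) C(spectrum ℂ U, ℂ) := Matrix.of fun i j =>
    algebraMap ℂ _ (tridiagEntry a b c (i.val : ℤ) (j.val : ℤ))
      + (if i.val = 0 ∧ j.val + 1 = k then c (lastSite k) else 0) • ι
      + (if i.val + 1 = k ∧ j.val = 0 then b (lastSite k) else 0) • star ι
  have hφA (i j : Fin k) : φ (A i j) = tridiagEntry a b c (i.val : ℤ) (j.val : ℤ) • 1
      + (if i.val = 0 ∧ j.val + 1 = k then c (lastSite k) else 0) • U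
      + (if i.val + 1 = k ∧ j.val = 0 then b (lastSite k) else 0) • star U := by
    simp only [A, Matrix.of_apply, map_add, map_smul, map_star, hφι, map_one,
      Algebra.algebraMap_eq_smul_one]
  have hΨA : Ψ A = laurentOperator a b c := by
    change ∑ i, ∑ j, φ (A i j) * cellUnit i j = _
    ext x n
    rw [lp_sum_apply, Finset.sum_eq_single (siteIndex k n)]
    · rw [lp_sum_apply]
      have hn := ediv_mul_add_siteIndex k n
      set i := siteIndex k n with hi
      have hrow := sum_block_eq_tridiagAction a b c (fun j => x (j + n / k * k)) i
      rw [tridiagAction_shift, ← hn] at hrow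
      rw [laurentOperator_apply]
      refine Eq.trans (Finset.sum_congr rfl fun j _ => ?_) hrow
      rw [mul_apply_eq_comp, hφA, hUs, hUdef]
      have e (q : ℤ) : bilateralShift (q * k) (cellUnit i j x) n =
          x (j.val + q * k + n / k * k) := by
        rw [bilateralShift_apply, cellUnit_apply, siteIndex_add_mul, if_pos hi.symm]
        exact congrArg (x : ℤ → ℂ) (by linarith)
      have e0 : cellUnit i j x n = x (j.val + n / k * k) := by
        rw [cellUnit_apply, if_pos hi.symm]
        exact congrArg (x : ℤ → ℂ) (by linarith)
      have e1 := e (-1)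
      have e2 := e 1
      rw [_root_.add_apply, _root_.add_apply,
        _root_.smul_apply, _root_.smul_apply,
        _root_.smul_apply, lp.coeFn_add, lp.coeFn_add, Pi.add_apply, Pi.add_apply,
        lp.coeFn_smul, lp.coeFn_smul, lp.coeFn_smul, Pi.smul_apply, Pi.smul_apply, Pi.smul_apply,
        e1, e2, one_apply_eq_self, e0]
      simp only [smul_eq_mul, ite_mul, zero_mul, one_mul, neg_mul, sub_eq_add_neg]
    · intro i _ hi
      rw [lp_sum_apply]
      refine Finset.sum_eq_zero fun j _ => ?_
      rw [(hcomm (A i j) i j).eq, mul_apply_eq_comp, cellUnit_apply, if_neg hi.symm]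
    · simp
  -- Over the commutative ring C(σ(U)) a matrix is invertible once its determinant vanishes nowhere.
  -- Only the inclusion of σ(U) in the circle is needed.
  have hdet : IsUnit (algebraMap ℂ (Matrix (Fin k) (Fin k) C(spectrum ℂ U, ℂ)) μ - A) := by
    rw [Matrix.isUnit_iff_isUnit_det, ContinuousMap.isUnit_iff_forall_ne_zero]
    intro z
    have hz : ‖(z : ℂ)‖ = 1 := by
      simpa using spectrum.subset_circle_of_unitary hUu z.2
    have h := hcon z hz
    rw [spectrum.notMem_iff, Matrix.isUnit_iff_isUnit_det, isUnit_iff_ne_zero] at h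
    let ev : C(spectrum ℂ U, ℂ) →+* ℂ := (ContinuousMap.evalAlgHom ℂ ℂ z).toRingHom
    have hev : ev (algebraMap ℂ (Matrix (Fin k) (Fin k) C(spectrum ℂ U, ℂ)) μ - A).det =
        (algebraMap ℂ (Matrix (Fin k) (Fin k) ℂ) μ - symbol a b c z).det := by
      rw [RingHom.map_det]
      congr 1
      ext i j
      have hA : (A i j) z = symbol a b c z i j := by
        have hzi : (z : ℂ)⁻¹ = (starRingEnd ℂ) z := by
          rw [Complex.inv_def, Complex.normSq_eq_norm_sq, hz]; simp
        simp only [A, symbol, Matrix.of_apply, hzi]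
        split_ifs <;> simp [ι]
      rw [RingHom.mapMatrix_apply, Matrix.map_apply, Matrix.sub_apply, Matrix.sub_apply, map_sub,
        Matrix.algebraMap_matrix_apply, Matrix.algebraMap_matrix_apply, ← hA]
      split_ifs
      · rfl
      · rw [map_zero]; rfl
    exact fun h0 => h (hev ▸ h0)
  have hΨμ : Ψ (algebraMap ℂ _ μ) = algebraMap ℂ _ μ := by
    rw [Algebra.algebraMap_eq_smul_one, Algebra.algebraMap_eq_smul_one, ← map_one Ψ]
    change ∑ i, ∑ j, φ _ * cellUnit i j = μ • ∑ i, ∑ j, φ _ * cellUnit i j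
    simp only [Matrix.smul_apply, map_smul, smul_mul_assoc, Finset.smul_sum]
  have hunit := hdet.map Ψ
  rwa [map_sub, hΨA, hΨμ] at hunit

theorem iUnion_brillouinZone {k : ℕ} [NeZero k] (a b c : Fin k → ℂ) {ℓ : ℝ} (hℓ : 0 < ℓ) :
    (⋃ α ∈ brillouinZone ℓ, spectrum ℂ (symbol a b c (Complex.exp (-Complex.I * ℓ * α)))) =
      spectrum ℂ (laurentOperator a b c) := by
  apply Set.Subset.antisymm
  · refine Set.iUnion₂_subset fun α _ =>
      spectrum_symbol_subset_spectrum_laurentOperator a b c ?_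
    rw [show -Complex.I * ℓ * α = ((-(ℓ * α) : ℝ) : ℂ) * Complex.I by push_cast; ring]
    exact Complex.norm_exp_ofReal_mul_I _
  · intro μ hμ
    obtain ⟨z, hz, hμz⟩ := spectrum_laurentOperator_subset a b c hμ
    -- The sign carries the range (-π, π] of the argument to the half-open zone [-π/ℓ, π/ℓ).
    refine Set.mem_iUnion₂.2 ⟨-Complex.arg z / ℓ, ⟨?_, ?_⟩, ?_⟩
    · exact div_le_div_of_nonneg_right (neg_le_neg (Complex.arg_le_pi z)) hℓ.le
    · exact div_lt_div_of_pos_right (neg_lt.1 (Complex.neg_pi_lt_arg z)) hℓ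
    · have hℓ' : (ℓ : ℂ) ≠ 0 := by exact_mod_cast hℓ.ne'
      have h1 : -Complex.I * ℓ * ((-Complex.arg z / ℓ : ℝ) : ℂ) = Complex.arg z * Complex.I := by
        push_cast
        field_simp
      have h2 := Complex.norm_mul_exp_arg_mul_I z
      rw [hz, Complex.ofReal_one, one_mul] at h2
      rwa [h1, h2]

/-! ### Hausdorff convergence of the circulant spectra. -/

/-- The determinant is the product of the μ - ν over the eigenvalues; if every factor had norm at
least ε, the product would be at least ε to the number of factors. -/
theorem Matrix.exists_mem_spectrum_norm_sub_lt {n : Type*} [Fintype n] [DecidableEq n]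
    (A : Matrix n n ℂ) (μ : ℂ) {ε : ℝ} (hε : 0 ≤ ε)
    (h : ‖(Matrix.scalar n μ - A).det‖ < ε ^ Fintype.card n) :
    ∃ ν ∈ spectrum ℂ A, ‖μ - ν‖ < ε := by
  by_contra! hcon
  refine h.not_ge ?_
  have hs := IsAlgClosed.splits A.charpoly
  rw [← Matrix.eval_charpoly, hs.eval_eq_prod_roots_of_monic A.charpoly_monic,
    ← A.charpoly_natDegree_eq_dim, hs.natDegree_eq_card_roots]
  have key (s : Multiset ℂ) (hs : ∀ ν ∈ s, ε ≤ ‖μ - ν‖) :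
      ε ^ s.card ≤ ‖(s.map fun ν => μ - ν).prod‖ := by
    induction s using Multiset.induction_on with
    | empty => simp
    | cons ν s ih =>
      rw [Multiset.card_cons, Multiset.map_cons, Multiset.prod_cons, norm_mul, pow_succ']
      exact mul_le_mul (hs ν (Multiset.mem_cons_self ν s))
        (ih fun ν' h' => hs ν' (Multiset.mem_cons_of_mem h')) (pow_nonneg hε _) (norm_nonneg _)
  exact key _ fun ν hν => hcon ν
    (Matrix.mem_spectrum_iff_isRoot_charpoly.2 (Polynomial.isRoot_of_mem_roots hν))

/-- Every point of the unit circle is within `2 * π / m` of an `m`-th root of unity. -/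
theorem exists_rootOfUnity_dist_le {z : ℂ} (hz : ‖z‖ = 1) {m : ℕ} (hm : 0 < m) :
    ∃ j ∈ Finset.range m,
      dist z (Complex.exp (2 * Real.pi * Complex.I * j / m)) ≤ 2 * Real.pi / m := by
  have hpi := Real.pi_pos
  have hm' : (0 : ℝ) < m := by exact_mod_cast hm
  obtain ⟨θ, hθ0, hθ1, hθ⟩ : ∃ θ : ℝ, 0 ≤ θ ∧ θ < 2 * Real.pi ∧
      Complex.exp (Complex.I * θ) = z := by
    have h2 := Complex.norm_mul_exp_arg_mul_I z
    rw [hz, Complex.ofReal_one, one_mul] at h2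
    rcases le_or_gt 0 (Complex.arg z) with h | h
    · exact ⟨_, h, by linarith [Complex.arg_le_pi z], by rw [mul_comm, h2]⟩
    · refine ⟨Complex.arg z + 2 * Real.pi, by linarith [Complex.neg_pi_lt_arg z], by linarith, ?_⟩
      rw [show Complex.I * ((Complex.arg z + 2 * Real.pi : ℝ) : ℂ) =
        Complex.arg z * Complex.I + 2 * Real.pi * Complex.I by push_cast; ring,
        Complex.exp_periodic, h2]
  have hfl := Nat.floor_le (show 0 ≤ m * θ / (2 * Real.pi) by positivity)
  have hfl' := Nat.lt_floor_add_one (m * θ / (2 * Real.pi))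
  -- The root of unity preceding z on the circle; θ < 2π gives j < m, and the chord is at most the
  -- arc.
  set j := ⌊m * θ / (2 * Real.pi)⌋₊ with hj
  rw [le_div_iff₀ (by positivity)] at hfl
  rw [div_lt_iff₀ (by positivity)] at hfl'
  refine ⟨j, ?_, ?_⟩
  · rw [Finset.mem_range, hj, Nat.floor_lt (by positivity), div_lt_iff₀ (by positivity)]
    exact mul_lt_mul_of_pos_left hθ1 hm'
  · have h1 : z - Complex.exp (2 * Real.pi * Complex.I * j / m) =
        Complex.exp (2 * Real.pi * Complex.I * j / m) *
          (Complex.exp (Complex.I * ((θ - 2 * Real.pi * j / m : ℝ) : ℂ)) - 1) := by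
      rw [mul_sub, ← Complex.exp_add, ← hθ, mul_one]
      congr 2
      push_cast
      ring
    have h2 : ‖Complex.exp (2 * Real.pi * Complex.I * j / m)‖ = 1 := by
      rw [show 2 * Real.pi * Complex.I * j / m = ((2 * Real.pi * j / m : ℝ) : ℂ) * Complex.I by
        push_cast; ring]
      exact Complex.norm_exp_ofReal_mul_I _
    rw [dist_eq_norm, h1, norm_mul, h2, one_mul]
    refine (Real.norm_exp_I_mul_ofReal_sub_one_le).trans ?_
    rw [Real.norm_eq_abs, abs_le]
    have h3 : θ = m * θ / m := by field_simp
    constructor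
    · have : 2 * Real.pi * j / m ≤ θ := by rw [div_le_iff₀ hm']; linarith
      have : 0 ≤ 2 * Real.pi / m := by positivity
      linarith
    · rw [sub_le_iff_le_add, ← add_div, le_div_iff₀ hm']
      linarith

theorem continuousOn_det_sub_symbol {k : ℕ} [NeZero k] (a b c : Fin k → ℂ) :
    ContinuousOn (fun p : ℂ × ℂ => (Matrix.scalar (Fin k) p.2 - symbol a b c p.1).det)
      {p | p.1 ≠ 0} := by
  refine continuousOn_iff_continuous_domRestrict.2 (Continuous.matrix_det ?_)
  refine continuous_matrix fun i j => ?_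
  have h1 : Continuous fun p : {p : ℂ × ℂ | p.1 ≠ 0} => (p.1.1)⁻¹ :=
    Continuous.inv₀ (by fun_prop) fun p => p.2
  simp only [Matrix.sub_apply, symbol, Matrix.of_apply, Matrix.scalar_apply, Matrix.diagonal_apply]
  split_ifs <;> fun_prop

theorem tendsto_hausdorffEDist_circulantMatrix {k : ℕ} [NeZero k] (a b c : Fin k → ℂ) :
    Filter.Tendsto (fun m : ℕ => Metric.hausdorffEDist (spectrum ℂ (circulantMatrix a b c m))
      (spectrum ℂ (laurentOperator a b c))) Filter.atTop (nhds 0) := by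
  rw [ENNReal.tendsto_nhds_zero]
  intro ε hε
  obtain ⟨δ, hδ0, hδε⟩ := ENNReal.lt_iff_exists_nnreal_btwn.1 hε
  have hδ : (0 : ℝ) < δ := by exact_mod_cast hδ0
  have hK : IsCompact (Metric.sphere (0 : ℂ) 1 ×ˢ spectrum ℂ (laurentOperator a b c)) :=
    (isCompact_sphere _ _).prod (spectrum.isCompact _)
  have huc := hK.uniformContinuousOn_of_continuous
    ((continuousOn_det_sub_symbol a b c).mono fun p hp => by
      have h1 : ‖p.1‖ = 1 := by simpa using hp.1
      exact norm_ne_zero_iff.1 (by rw [h1]; exact one_ne_zero))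
  -- The tolerance δ ^ k is what the determinant criterion needs for an eigenvalue within δ.
  -- Compactness in both variables gives one η for all μ.
  obtain ⟨η, hη, huc⟩ := Metric.uniformContinuousOn_iff.1 huc (δ ^ k) (by positivity)
  have hlim : ∀ᶠ m : ℕ in Filter.atTop, 2 * Real.pi / m < η :=
    (tendsto_const_div_atTop_nhds_zero_nat (2 * Real.pi)).eventually (gt_mem_nhds hη)
  filter_upwards [hlim, Filter.eventually_gt_atTop 0] with m hmη hm
  have hnorm (j : ℕ) : ‖Complex.exp (2 * Real.pi * Complex.I * j / m)‖ = 1 := by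
    rw [show 2 * Real.pi * Complex.I * j / m = ((2 * Real.pi * j / m : ℝ) : ℂ) * Complex.I by
      push_cast; ring]
    exact Complex.norm_exp_ofReal_mul_I _
  refine Metric.hausdorffEDist_le_of_mem_edist (fun μ hμ => ?_) fun μ hμ => ?_
  -- This direction is exact: the circulant spectrum is contained in the Laurent spectrum.
  · rw [spectrum_circulantMatrix a b c hm] at hμ
    obtain ⟨j, -, hμj⟩ := Set.mem_iUnion₂.1 hμ
    exact ⟨μ, spectrum_symbol_subset_spectrum_laurentOperator a b c (hnorm j) hμj, by simp⟩
  · obtain ⟨z, hz, hμz⟩ := spectrum_laurentOperator_subset a b c hμ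
    obtain ⟨j, hj, hdist⟩ := exists_rootOfUnity_dist_le hz hm
    set w := Complex.exp (2 * Real.pi * Complex.I * j / m) with hw
    have h0 : (Matrix.scalar (Fin k) μ - symbol a b c z).det = 0 := by
      rw [← Matrix.eval_charpoly]
      exact Matrix.mem_spectrum_iff_isRoot_charpoly.1 hμz
    have h1 := huc (w, μ) ⟨by simpa using hnorm j, hμ⟩ (z, μ) ⟨by simpa using hz, hμ⟩
      (by rw [Prod.dist_eq, dist_self, dist_comm]; exact max_lt (hdist.trans_lt hmη) hη)
    simp only [h0, dist_zero_right] at h1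
    obtain ⟨ν, hν, hνμ⟩ := Matrix.exists_mem_spectrum_norm_sub_lt (symbol a b c w) μ hδ.le
      (by rwa [Fintype.card_fin])
    refine ⟨ν, ?_, le_trans ?_ hδε.le⟩
    · rw [spectrum_circulantMatrix a b c hm]
      exact Set.mem_iUnion₂.2 ⟨j, hj, hν⟩
    · rw [edist_dist, dist_eq_norm, ← ENNReal.ofReal_coe_nnreal]
      exact ENNReal.ofReal_le_ofReal hνμ.le

theorem mainTheorem4 (k : ℕ) [NeZero k] (a b c : Fin k → ℂ) (ℓ : ℝ) (hℓ : 0 < ℓ) :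
    (∀ m : ℕ, 0 < m →
      spectrum ℂ (circulantMatrix a b c m) =
        ⋃ j ∈ Finset.range m,
          spectrum ℂ (symbol a b c (Complex.exp (2 * Real.pi * Complex.I * j / m)))) ∧
    Filter.Tendsto
      (fun m : ℕ => Metric.hausdorffEDist (spectrum ℂ (circulantMatrix a b c m))
        (⋃ α ∈ brillouinZone ℓ,
          spectrum ℂ (symbol a b c (Complex.exp (-Complex.I * ℓ * α)))))
      Filter.atTop (nhds 0) ∧
    (⋃ α ∈ brillouinZone ℓ, spectrum ℂ (symbol a b c (Complex.exp (-Complex.I * ℓ * α)))) =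
      spectrum ℂ (laurentOperator a b c) := by
  rw [iUnion_brillouinZone a b c hℓ]
  exact ⟨fun m hm => spectrum_circulantMatrix a b c hm,
    tendsto_hausdorffEDist_circulantMatrix a b c, rfl⟩
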